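/- Let $\Omega\subset\mathbb R^2$ be open (for instance a convex domain) and let $\hat f:\mathbb R^2\to\mathbb R$ be a smooth function whose support is compact and contained in $\Omega$. Let $p$ be the solution, in the sense of distributions, of the initial value problem for the three-dimensional wave equation $$\partial_{tt}p(\xi,z;t)=\Delta_{\xi,z}\,p(\xi,z;t)\quad(t>0),\qquad p(\xi,z;0)=\hat f(\xi)\,\delta(z),\qquad \partial_tp(\xi,z;0)=0,\qquad \xi\in\mathbb R^2,\ z\in\mathbb R;$$ that is, $p$ is a distribution on $\mathbb R^3\times\mathbb R$ which vanishes on $\{t<0\}$ and satisfies $\partial_{tt}p-\Delta p=\hat f(\xi)\delta(z)\otimes\delta'(t)$, i.e. $$\langle p,\ \partial_{tt}\psi-\Delta\psi\rangle=-\int_{\mathbb R^2}\hat f(\xi)\,\partial_t\psi(\xi,0;0)\,d\xi\qquad\text{for all }\psi\in C_c^\infty(\mathbb R^3\times\mathbb R).$$ For $\xi\in\mathbb R^2$ and $r\ge 0$ let $$\mathcal M_2[\hat f](\xi;r)=\frac1{2\pi}\int_{S^1}\hat f(\xi+r\theta)\,ds(\theta)$$ denote the circular mean of $\hat f$. Then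 for every $\xi\in\partial\Omega$ and every $t>0$ the distribution $p$ is a continuous function in a neighbourhood of $(\xi,0;t)$, so that the in-plane point-detector data $m_2(\xi;t):=p(\xi,0;t)$ are well defined; the function $s\mapsto m_2(\xi;s)$ is integrable on $(0,t)$; and $$\mathcal M_2[\hat f](\xi;t)=2\int_0^t m_2(\xi;s)\,ds .$$ Consequently the recovery of $\hat f$ from the data $m_2$ is reduced to inverting the circular mean transform: if $R$ is any map that recovers every smooth function $g$ with compact support in $\Omega$ from its circular means $(\mathcal M_2[g](\xi;t))_{\xi\in\partial\Omega,\,t>0}$, then applying $R$ to the function $(\xi,t)\mapsto 2\int_0^t m_2(\xi;s)\,ds$ on $\partial\Omega\times(0,\infty)$ gives $\hat f$. -/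

import Mathlib

open MeasureTheory Set TopologicalSpace
open scoped Distributions LineDeriv ContDiff

noncomputable section

namespace Photoacoustic

/-- The illumination plane, with points `ξ`. -/
abbrev Plane : Type := EuclideanSpace ℝ (Fin 2)

/-- Physical space, with points `x = (ξ, z)`. -/
abbrev Space : Type := EuclideanSpace ℝ (Fin 3)

/-- Space-time, with points `(x, t)`. -/
abbrev SpaceTime : Type := Space × ℝ

/-- The point `(ξ, z)` of space. -/
def spacePoint (ξ : Plane) (z : ℝ) : Space := !₂[ξ 0, ξ 1, z]

/-- Real distributions on all of space-time. -/
abbrev SpaceTimeDistribution : Type := 𝓓'((⊤ : Opens SpaceTime), ℝ)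

/-- The spherical mean `M_n[f](x; r) = |S^{n-1}|⁻¹ ∫_{S^{n-1}} f (x + r θ) ds(θ)`. -/
def sphericalMean {n : ℕ} (f : EuclideanSpace ℝ (Fin n) → ℝ)
    (x : EuclideanSpace ℝ (Fin n)) (r : ℝ) : ℝ :=
  ((volume : Measure (EuclideanSpace ℝ (Fin n))).toSphere.real univ)⁻¹ *
    ∫ θ : Metric.sphere (0 : EuclideanSpace ℝ (Fin n)) 1,
      f (x + r • (θ : EuclideanSpace ℝ (Fin n)))
        ∂(volume : Measure (EuclideanSpace ℝ (Fin n))).toSphere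

/-- The unit vector of space-time in the time direction. -/
def timeDir : SpaceTime := (0, 1)

/-- The unit vector of space-time in the `i`-th spatial direction. -/
def spaceDir (i : Fin 3) : SpaceTime := (EuclideanSpace.single i 1, 0)

/-- `∂_{tt} p - Δ_x p`, with distributional derivatives. -/
def dAlembertian (p : SpaceTimeDistribution) : SpaceTimeDistribution :=
  ∂_{timeDir} (∂_{timeDir} p) - ∑ i : Fin 3, ∂_{spaceDir i} (∂_{spaceDir i} p)

/-- The pairing `⟨f(ξ) δ(z), φ⟩ = ∫_{ℝ²} f(ξ) φ(ξ, 0) dξ` of the layer with density `f` on the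
plane `z = 0` with a function `φ` on space. -/
def sheet (f : Plane → ℝ) (φ : Space → ℝ) : ℝ :=
  ∫ ξ : Plane, f ξ * φ (spacePoint ξ 0)

/-- `p` is the solution, in the sense of distributions, of the initial value problem
`∂_{tt} p = Δ p` for `t > 0`, `p(ξ, z; 0) = f(ξ) δ(z)`, `∂_t p(ξ, z; 0) = 0`. As usual for
distributional Cauchy problems `p` is extended by zero to `t < 0`, and the initial values
are encoded as the jumps at `t = 0`: `∂_{tt} p - Δ p = f(ξ) δ(z) ⊗ δ'(t)` on space-time. -/
structure IsPressureWave (f : Plane → ℝ) (p : SpaceTimeDistribution) : Prop where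
  eq_zero_of_neg : ∀ ψ : 𝓓((⊤ : Opens SpaceTime), ℝ),
    tsupport ψ ⊆ {y : SpaceTime | y.2 < 0} → p ψ = 0
  wave_eq : ∀ ψ : 𝓓((⊤ : Opens SpaceTime), ℝ),
    dAlembertian p ψ = - sheet f (fun x : Space => (∂_{timeDir} ψ) (x, (0 : ℝ)))

/-- Near the point `y` the distribution `p` is a continuous function, whose value at `y`
is `v`. -/
def HasPointValue (p : SpaceTimeDistribution) (y : SpaceTime) (v : ℝ) : Prop :=
  ∃ (U : Set SpaceTime) (g : SpaceTime → ℝ), IsOpen U ∧ y ∈ U ∧ ContinuousOn g U ∧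
    (∀ ψ : 𝓓((⊤ : Opens SpaceTime), ℝ), tsupport ψ ⊆ U → p ψ = ∫ w : SpaceTime, g w * ψ w) ∧
    g y = v

open Classical in
/-- The value of `p` at `y`, when it has one (and `0` otherwise). -/
def pointValue (p : SpaceTimeDistribution) (y : SpaceTime) : ℝ :=
  if h : ∃ v : ℝ, HasPointValue p y v then h.choose else 0

/-- The point detector data `m₂(ξ; t) = p(ξ, 0; t)`. -/
def pointData (p : SpaceTimeDistribution) (ξ : Plane) (t : ℝ) : ℝ :=
  pointValue p (spacePoint ξ 0, t)

end Photoacoustic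

end

/-!
The wave equation is tested against the advanced potential
`Φ(x, t) = (4π)⁻¹ ∫ |y|⁻¹ ψ(x + y, t + |y|) dy` of a test function `ψ`, which satisfies `□Φ = ψ` and
may be cut off at negative times, where `p` vanishes. The result is
`⟨p, ψ⟩ = - ∫ f(ξ) ∂_t Φ(ξ, 0; 0) dξ`. To avoid boundary terms at the vertex of the light cone,
`□Φ = ψ` is obtained by integrating by parts on the hyperboloids `t = √(ε² + |y|²)` and letting
`ε → 0`.

Polar coordinates in the plane, with `t = √(r² + z²)`, and an integration by parts in `t` turn this
pairing into that of `ψ` with the function `½ ∂_t M₂[f](ξ; √(t² - z²))`, as long as `ψ` is supported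
in `{t > |z|}`. On the plane `z = 0` this function is `½ ∂_t M₂[f](ξ; t)`; it remains to integrate
in time, starting from `M₂[f](ξ; 0) = f(ξ)`, which vanishes for `ξ ∈ ∂Ω`.
-/

noncomputable section

open Filter Module
open scoped Topology Convolution RealInnerProductSpace

namespace Photoacoustic

section TestFunction

variable {E F : Type*} [NormedAddCommGroup E] [NormedSpace ℝ E] [NormedAddCommGroup F]
  [NormedSpace ℝ F] {Ω : Opens E}

theorem coe_lineDerivOp (φ : 𝓓(Ω, F)) (v : E) :
    ((∂_{v} φ : 𝓓(Ω, F)) : E → F) = fun x => fderiv ℝ φ x v := by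
  ext x
  change TestFunction.lineDerivCLM ℝ v φ x = _
  rw [TestFunction.lineDerivCLM_apply_of_le (by simp)]
  exact ((φ.contDiff.differentiable (by simp)) x).lineDeriv_eq_fderiv

theorem lineDerivOp_comm (φ : 𝓓(Ω, F)) (v w : E) : ∂_{v} (∂_{w} φ) = ∂_{w} (∂_{v} φ) := by
  have second_deriv (a b x : E) : (∂_{a} (∂_{b} φ)) x = fderiv ℝ (fderiv ℝ φ) x a b := by
    have hd : DifferentiableAt ℝ (fderiv ℝ φ) x :=
      (φ.contDiff.fderiv_right (m := ∞) (by simp)).differentiable (by simp) x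
    simpa only [coe_lineDerivOp, fderiv_fun_const, Pi.zero_apply, ContinuousLinearMap.comp_zero,
      zero_add, ContinuousLinearMap.flip_apply] using
      congrArg (fun L => L a) (fderiv_clm_apply hd (differentiableAt_const b))
  ext x
  rw [second_deriv, second_deriv]
  refine (φ.contDiff.contDiffAt.isSymmSndFDerivAt ?_).eq v w
  rw [minSmoothness_of_isRCLikeNormedField]
  exact WithTop.coe_le_coe.2 le_top

end TestFunction

section PowerSingularity

variable {E : Type*} [NormedAddCommGroup E] [NormedSpace ℝ E] [FiniteDimensional ℝ E]
  [MeasurableSpace E] [BorelSpace E] {μ : Measure E} [μ.IsAddHaarMeasure]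

theorem locallyIntegrable_inv_norm_pow {k : ℕ} (hk : k < finrank ℝ E) :
    LocallyIntegrable (fun y : E => (‖y‖ ^ k)⁻¹) μ := by
  refine locallyIntegrable_of_norm_le_rpow (C := 1) (α := k) (by omega) (by exact_mod_cast hk)
    (Eventually.of_forall fun y => ?_) (by fun_prop)
  simp [Real.rpow_neg]

theorem ae_ne_of_finrank_pos (h : 0 < finrank ℝ E) (x : E) : ∀ᵐ y ∂μ, y ≠ x := by
  have : Nontrivial E := nontrivial_of_finrank_pos h
  simp [ae_iff]

theorem integrable_indicator_ball_inv_norm_pow {k : ℕ} (hk : k < finrank ℝ E) (C R : ℝ) :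
    Integrable ((Metric.ball (0 : E) R).indicator fun y => C * (‖y‖ ^ k)⁻¹) μ := by
  refine (integrable_indicator_iff measurableSet_ball).2 (Integrable.const_mul ?_ C)
  exact ((locallyIntegrable_inv_norm_pow hk).integrableOn_isCompact
    (isCompact_closedBall 0 R)).mono_set Metric.ball_subset_closedBall

theorem integrable_of_norm_le_inv_norm_pow {G : Type*} [NormedAddCommGroup G] {g : E → G}
    {k : ℕ} {C R : ℝ} (hk : k < finrank ℝ E) (hm : AEStronglyMeasurable g μ)
    (hg : ∀ᵐ y ∂μ, ‖g y‖ ≤ C * (‖y‖ ^ k)⁻¹) (hR : ∀ y, R ≤ ‖y‖ → g y = 0) : Integrable g μ := by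
  refine (integrable_indicator_ball_inv_norm_pow hk C R).mono' hm ?_
  filter_upwards [hg] with y hy
  refine le_indicator_apply (fun _ => hy) fun hyR => ?_
  rw [hR y (by simpa using hyR), norm_zero]

end PowerSingularity

theorem exists_forall_norm_ge_comp_add_eq_zero {E F : Type*} [NormedAddCommGroup E]
    [NormedAddCommGroup F] {χ : E × F → ℝ} (hχ : HasCompactSupport χ) :
    ∃ R, ∀ (w : E × F) (y : E) (t : F), R + ‖w‖ ≤ ‖y‖ → χ (w + (y, t)) = 0 := by
  obtain ⟨R, -, hR⟩ := hχ.exists_pos_le_norm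
  refine ⟨R, fun w y t hy => hR _ ?_⟩
  have h_fst : ‖y‖ ≤ ‖(y, t)‖ := norm_fst_le (y, t)
  have h_sub : ‖(y, t)‖ ≤ ‖w + (y, t)‖ + ‖w‖ := by simpa using norm_sub_le (w + (y, t)) w
  linarith

section Cone

variable {E : Type*} [NormedAddCommGroup E] {ε : ℝ} {y : E}

/-- The distance of `y` from the origin, regularised at scale `ε`. -/
def coneDist (ε : ℝ) (y : E) : ℝ := √(ε ^ 2 + ‖y‖ ^ 2)

theorem coneDist_zero (y : E) : coneDist 0 y = ‖y‖ := by
  simp [coneDist]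

theorem coneDist_sq (ε : ℝ) (y : E) : coneDist ε y ^ 2 = ε ^ 2 + ‖y‖ ^ 2 :=
  Real.sq_sqrt (by positivity)

theorem coneDist_pos (hε : 0 < ε) (y : E) : 0 < coneDist ε y :=
  Real.sqrt_pos.2 (by positivity)

theorem norm_le_coneDist (ε : ℝ) (y : E) : ‖y‖ ≤ coneDist ε y :=
  Real.le_sqrt_of_sq_le (by nlinarith [sq_nonneg ε])

theorem coneDist_smul [NormedSpace ℝ E] (hε : 0 ≤ ε) (y : E) :
    coneDist ε (ε • y) = ε * coneDist 1 y := by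
  rw [coneDist, norm_smul, Real.norm_of_nonneg hε, mul_pow, ← mul_one_add,
    Real.sqrt_mul (by positivity), Real.sqrt_sq hε, coneDist, one_pow]

theorem continuous_coneDist_left (y : E) : Continuous fun ε : ℝ => coneDist ε y := by
  unfold coneDist; fun_prop

theorem continuous_coneDist_right (ε : ℝ) : Continuous (coneDist ε : E → ℝ) := by
  unfold coneDist; fun_prop

theorem hasFDerivAt_coneDist [InnerProductSpace ℝ E] (hε : 0 < ε) (y : E) :
    HasFDerivAt (coneDist ε) ((coneDist ε y)⁻¹ • innerSL ℝ y) y := by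
  have h_sqrt := ((hasStrictFDerivAt_norm_sq y).hasFDerivAt.const_add (ε ^ 2)).sqrt (by positivity)
  refine h_sqrt.congr_fderiv ?_
  ext v
  simp only [coneDist, smul_apply, smul_eq_mul, nsmul_eq_mul, Nat.cast_ofNat]
  field_simp

variable {w : E × ℝ} {k : ℕ} {q : E → ℝ} {χ : E × ℝ → ℝ}

theorem norm_coneIntegrand_le {C : ℝ} {j m : ℕ} (hqj : ∀ y, |q y| ≤ ‖y‖ ^ j)
    (hC : ∀ z, ‖χ z‖ ≤ C) (hy : y ≠ 0) :
    ‖q y / coneDist ε y ^ (m + j) * χ (w + (y, coneDist ε y))‖ ≤ C * (‖y‖ ^ m)⁻¹ := by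
  have hy_pos : 0 < ‖y‖ := norm_pos_iff.2 hy
  have hρ : ‖y‖ ≤ coneDist ε y := norm_le_coneDist ε y
  have hρ_pos : 0 < coneDist ε y := hy_pos.trans_le hρ
  have h_kernel : ‖q y / coneDist ε y ^ (m + j)‖ ≤ (‖y‖ ^ m)⁻¹ := calc
    ‖q y / coneDist ε y ^ (m + j)‖ = |q y| / coneDist ε y ^ (m + j) := by
      rw [norm_div, Real.norm_eq_abs, Real.norm_of_nonneg (by positivity)]
    _ ≤ ‖y‖ ^ j / ‖y‖ ^ (m + j) := by
      gcongr
      exact hqj y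
    _ = (‖y‖ ^ m)⁻¹ := by rw [pow_add]; field_simp
  rw [norm_mul, mul_comm]
  exact mul_le_mul (hC _) h_kernel (norm_nonneg _) ((norm_nonneg _).trans (hC 0))

variable [InnerProductSpace ℝ E]

theorem hasFDerivAt_comp_cone (hε : 0 < ε) (hχ : ContDiff ℝ 1 χ) (w : E × ℝ) (y : E) :
    HasFDerivAt (fun y => χ (w + (y, coneDist ε y)))
      ((fderiv ℝ χ (w + (y, coneDist ε y))).comp
        ((ContinuousLinearMap.id ℝ E).prod ((coneDist ε y)⁻¹ • innerSL ℝ y))) y :=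
  (hχ.differentiable one_ne_zero _).hasFDerivAt.comp y
    (((hasFDerivAt_id y).prodMk (hasFDerivAt_coneDist hε y)).const_add w)

theorem hasFDerivAt_div_coneDist_pow (hε : 0 < ε) (hq : ContDiff ℝ 1 q) (k : ℕ) (y : E) :
    HasFDerivAt (fun y => q y / coneDist ε y ^ k)
      ((coneDist ε y ^ k)⁻¹ • fderiv ℝ q y - (k * q y / coneDist ε y ^ (k + 2)) • innerSL ℝ y)
      y := by
  have hρ := coneDist_pos hε y
  have h_inv := ((hasDerivAt_pow k (coneDist ε y)).fun_inv (by positivity)).comp_hasFDerivAt y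
    (hasFDerivAt_coneDist hε y)
  have h_mul := (hq.differentiable one_ne_zero y).hasFDerivAt.mul h_inv
  refine h_mul.congr_fderiv ?_
  ext v
  rcases k with _ | k
  · simp [field]
  · simp [field]
    ring

theorem fderiv_div_coneDist_pow_mul (hε : 0 < ε) (hq : ContDiff ℝ 1 q) (k : ℕ) (y v : E) (c : ℝ) :
    fderiv ℝ (fun y => q y / coneDist ε y ^ k) y v * c =
      fderiv ℝ q y v / coneDist ε y ^ k * c -
        k * (q y * ⟪y, v⟫ / coneDist ε y ^ (k + 2) * c) := by
  simp only [(hasFDerivAt_div_coneDist_pow hε hq k y).fderiv, sub_apply, smul_apply,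
    innerSL_apply_apply, smul_eq_mul]
  ring

theorem mul_fderiv_comp_cone (hε : 0 < ε) (hχ : ContDiff ℝ 1 χ) (w : E × ℝ) (k : ℕ) (y v : E)
    (c : ℝ) :
    c / coneDist ε y ^ k * fderiv ℝ (fun y => χ (w + (y, coneDist ε y))) y v =
      c / coneDist ε y ^ k * fderiv ℝ χ (w + (y, coneDist ε y)) (v, 0) +
        c * ⟪y, v⟫ / coneDist ε y ^ (k + 1) *
          fderiv ℝ χ (w + (y, coneDist ε y)) (0, 1) := by
  have h_tangent : ((ContinuousLinearMap.id ℝ E).prod ((coneDist ε y)⁻¹ • innerSL ℝ y)) v =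
      (v, 0) + (⟪y, v⟫ / coneDist ε y) • ((0, 1) : E × ℝ) := by
    simp [div_eq_inv_mul]
  rw [(hasFDerivAt_comp_cone hε hχ w y).fderiv, ContinuousLinearMap.comp_apply, h_tangent, map_add,
    map_smul, smul_eq_mul, mul_add, pow_succ]
  field_simp

variable [MeasurableSpace E] [BorelSpace E] [FiniteDimensional ℝ E]

/-- The integral `∫ q(y) ρ⁻ᵏ χ(w + (y, ρ)) dy` with `ρ = √(ε² + |y|²)`. For `ε = 0` it runs over the
forward light cone with vertex `w`, for `ε > 0` over a hyperboloid approximating this cone. -/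
def coneIntegral (ε : ℝ) (w : E × ℝ) (k : ℕ) (q : E → ℝ) (χ : E × ℝ → ℝ) : ℝ :=
  ∫ y : E, q y / coneDist ε y ^ k * χ (w + (y, coneDist ε y))

theorem integrable_coneIntegral (hε : 0 < ε) (hq : Continuous q) (hχ : Continuous χ)
    (hχc : HasCompactSupport χ) :
    Integrable fun y => q y / coneDist ε y ^ k * χ (w + (y, coneDist ε y)) := by
  have hρ := continuous_coneDist_right (E := E) ε
  have h_kernel : Continuous fun y => q y / coneDist ε y ^ k :=
    hq.div (hρ.pow k) fun y => (pow_pos (coneDist_pos hε y) k).ne'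
  obtain ⟨R, hR⟩ := exists_forall_norm_ge_comp_add_eq_zero hχc
  refine (h_kernel.mul (by fun_prop)).integrable_of_hasCompactSupport ?_
  refine HasCompactSupport.intro (isCompact_closedBall 0 (R + ‖w‖)) fun y hy => ?_
  have hy' : R + ‖w‖ < ‖y‖ := by simpa using hy
  simp only [Pi.mul_apply, hR w y _ hy'.le, mul_zero]

theorem coneIntegral_sum_weight {ι : Type*} {s : Finset ι} {q : ι → E → ℝ} (hε : 0 < ε)
    (hq : ∀ i ∈ s, Continuous (q i)) (hχ : Continuous χ) (hχc : HasCompactSupport χ) :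
    coneIntegral ε w k (fun y => ∑ i ∈ s, q i y) χ = ∑ i ∈ s, coneIntegral ε w k (q i) χ := by
  simp only [coneIntegral, Finset.sum_div, Finset.sum_mul]
  exact integral_finsetSum s fun i hi => integrable_coneIntegral hε (hq i hi) hχ hχc

theorem coneIntegral_norm_sq (hε : 0 < ε) (hχ : Continuous χ) (hχc : HasCompactSupport χ) :
    coneIntegral ε w (k + 2) (fun y => ‖y‖ ^ 2) χ =
      coneIntegral ε w k 1 χ - ε ^ 2 * coneIntegral ε w (k + 2) 1 χ := by
  rw [coneIntegral, coneIntegral, coneIntegral, ← integral_const_mul, ← integral_sub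
    (integrable_coneIntegral hε continuous_one hχ hχc)
    ((integrable_coneIntegral hε continuous_one hχ hχc).const_mul _)]
  refine integral_congr_ae (Eventually.of_forall fun y => ?_)
  have hρ := coneDist_pos hε y
  simp only [Pi.one_apply, pow_add, eq_sub_of_add_eq' (coneDist_sq ε y).symm]
  field_simp

theorem coneIntegral_fderiv_space (hε : 0 < ε) (hq : ContDiff ℝ 1 q) (hχ : ContDiff ℝ 1 χ)
    (hχc : HasCompactSupport χ) (v : E) :
    coneIntegral ε w k q (fun z => fderiv ℝ χ z (v, 0)) =
      k * coneIntegral ε w (k + 2) (fun y => q y * ⟪y, v⟫) χ -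
        coneIntegral ε w k (fun y => fderiv ℝ q y v) χ -
        coneIntegral ε w (k + 1) (fun y => q y * ⟪y, v⟫) (fun z => fderiv ℝ χ z (0, 1)) := by
  have hq' : Continuous fun y => fderiv ℝ q y v :=
    (hq.continuous_fderiv one_ne_zero).clm_apply continuous_const
  have hqv : Continuous fun y => q y * ⟪y, v⟫ := hq.continuous.mul (by fun_prop)
  have hχ' (a : E × ℝ) : Continuous fun z => fderiv ℝ χ z a :=
    (hχ.continuous_fderiv one_ne_zero).clm_apply continuous_const
  have hχc' (a : E × ℝ) : HasCompactSupport fun z => fderiv ℝ χ z a := hχc.fderiv_apply (𝕜 := ℝ) a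
  have hK := integrable_coneIntegral (w := w) (k := k) hε hq' hχ.continuous hχc
  have hK' := integrable_coneIntegral (w := w) (k := k + 2) hε hqv hχ.continuous hχc
  have hX := integrable_coneIntegral (w := w) (k := k) hε hq.continuous (hχ' (v, 0)) (hχc' _)
  have hX' := integrable_coneIntegral (w := w) (k := k + 1) hε hqv (hχ' (0, 1)) (hχc' _)
  have deriv_kernel (y : E) := fderiv_div_coneDist_pow_mul hε hq k y v (χ (w + (y, coneDist ε y)))
  have deriv_cone (y : E) := mul_fderiv_comp_cone hε hχ w k y v (q y)
  have ibp := integral_mul_fderiv_eq_neg_fderiv_mul_of_integrable (v := v) (μ := volume)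
    ((hK.sub (hK'.const_mul k)).congr (.of_forall fun y => (deriv_kernel y).symm))
    ((hX.add hX').congr (.of_forall fun y => (deriv_cone y).symm))
    (integrable_coneIntegral (w := w) (k := k) hε hq.continuous hχ.continuous hχc)
    (fun y _ => (hasFDerivAt_div_coneDist_pow hε hq k y).differentiableAt)
    (fun y _ => (hasFDerivAt_comp_cone hε hχ w y).differentiableAt)
  simp only [deriv_kernel, deriv_cone] at ibp
  rw [integral_add hX hX', integral_sub hK (hK'.const_mul k), integral_const_mul] at ibp
  unfold coneIntegral
  linarith

theorem tendsto_coneIntegral {j m : ℕ} (hm : m < finrank ℝ E) (hq : Continuous q)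
    (hqj : ∀ y, |q y| ≤ ‖y‖ ^ j) (hχ : Continuous χ) (hχc : HasCompactSupport χ) (w : E × ℝ) :
    Tendsto (fun ε => coneIntegral ε w (m + j) q χ) (𝓝[>] 0)
      (𝓝 (coneIntegral 0 w (m + j) q χ)) := by
  obtain ⟨R, hR⟩ := exists_forall_norm_ge_comp_add_eq_zero hχc
  obtain ⟨C, hC⟩ := hχ.bounded_above_of_compact_support hχc
  have h_ne := ae_ne_of_finrank_pos (μ := volume) (Nat.zero_lt_of_lt hm) (0 : E)
  refine tendsto_integral_filter_of_dominated_convergence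
    ((Metric.ball 0 (R + ‖w‖)).indicator fun y => C * (‖y‖ ^ m)⁻¹) ?_ ?_
    (integrable_indicator_ball_inv_norm_pow hm C (R + ‖w‖)) ?_
  · filter_upwards [self_mem_nhdsWithin] with ε hε
    exact (integrable_coneIntegral hε hq hχ hχc).aestronglyMeasurable
  · refine .of_forall fun ε => ?_
    filter_upwards [h_ne] with y hy
    refine le_indicator_apply (fun _ => norm_coneIntegrand_le hqj hC hy) fun hyR => ?_
    rw [hR w y _ (by simpa using hyR), mul_zero, norm_zero]
  · filter_upwards [h_ne] with y hy
    have hρ := continuous_coneDist_left y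
    have h_cont : ContinuousAt
        (fun ε => q y / coneDist ε y ^ (m + j) * χ (w + (y, coneDist ε y))) 0 :=
      (continuousAt_const.div (hρ.pow _).continuousAt (by simp [coneDist_zero, hy])).mul
        (by fun_prop)
    exact h_cont.tendsto.mono_left nhdsWithin_le_nhds

theorem tendsto_sq_mul_coneIntegral (hk : k < finrank ℝ E) (hχ : Continuous χ)
    (hχc : HasCompactSupport χ) (w : E × ℝ) :
    Tendsto (fun ε => ε ^ 2 * coneIntegral ε w (k + 2) 1 χ) (𝓝[>] 0) (𝓝 0) := by
  have h_one := tendsto_coneIntegral (q := 1) (j := 0) hk continuous_one (by simp) hχ hχc w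
  have h_norm_sq := tendsto_coneIntegral (q := fun y => ‖y‖ ^ 2) (j := 2) hk (by fun_prop)
    (fun y => by simp) hχ hχc w
  have h_limits_eq : coneIntegral 0 w (k + 2) (fun y => ‖y‖ ^ 2) χ = coneIntegral 0 w k 1 χ := by
    have h_ne := ae_ne_of_finrank_pos (μ := volume) (Nat.zero_lt_of_lt hk) (0 : E)
    refine integral_congr_ae ?_
    filter_upwards [h_ne] with y hy
    have hy_norm : ‖y‖ ≠ 0 := norm_ne_zero_iff.2 hy
    rw [coneDist_zero, Pi.one_apply, pow_add]
    field_simp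
  rw [h_limits_eq] at h_norm_sq
  have h_diff := h_one.sub h_norm_sq
  rw [add_zero, sub_self] at h_diff
  refine h_diff.congr' ?_
  filter_upwards [self_mem_nhdsWithin] with ε hε
  rw [coneIntegral_norm_sq hε hχ hχc, sub_sub_cancel]

theorem integrable_coneIntegral_zero (hk : k < finrank ℝ E) (hχ : Continuous χ)
    (hχc : HasCompactSupport χ) (w : E × ℝ) :
    Integrable fun y : E => (1 : E → ℝ) y / coneDist 0 y ^ k * χ (w + (y, coneDist 0 y)) := by
  obtain ⟨R, hR⟩ := exists_forall_norm_ge_comp_add_eq_zero hχc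
  obtain ⟨C, hC⟩ := hχ.bounded_above_of_compact_support hχc
  have h_ne := ae_ne_of_finrank_pos (μ := volume) (Nat.zero_lt_of_lt hk) (0 : E)
  have hρ := continuous_coneDist_right (E := E) 0
  refine integrable_of_norm_le_inv_norm_pow hk (C := C) (R := R + ‖w‖) ?_ ?_ fun y hy => ?_
  · exact (Measurable.div measurable_one (hρ.measurable.pow_const k)).aestronglyMeasurable.mul
      (by fun_prop)
  · filter_upwards [h_ne] with y hy
    exact norm_coneIntegrand_le (j := 0) (fun y => by simp) hC hy
  · rw [hR w y _ hy, mul_zero]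

theorem integrable_inv_coneDist_one_pow (hk : finrank ℝ E < k) :
    Integrable fun y : E => (coneDist 1 y ^ k)⁻¹ := by
  refine (integrable_rpow_neg_one_add_norm_sq (μ := volume) (r := k) (by exact_mod_cast hk)).congr
    (Eventually.of_forall fun y => ?_)
  simp only [coneDist, one_pow]
  rw [Real.sqrt_eq_rpow, ← Real.rpow_mul_natCast (by positivity),
    ← Real.rpow_neg (by positivity)]
  congr 1
  ring

theorem pow_mul_coneIntegral_eq (hε : 0 < ε) (w : E × ℝ) (χ : E × ℝ → ℝ) (m : ℕ) :
    ε ^ m * coneIntegral ε w (finrank ℝ E + m) 1 χ =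
      ∫ y : E, (coneDist 1 y ^ (finrank ℝ E + m))⁻¹ * χ (w + ε • (y, coneDist 1 y)) := by
  have h_scale := Measure.integral_comp_smul volume
    (fun y : E => 1 / coneDist ε y ^ (finrank ℝ E + m) * χ (w + (y, coneDist ε y))) ε
  rw [abs_of_pos (by positivity), smul_eq_mul, inv_mul_eq_div,
    eq_div_iff (by positivity)] at h_scale
  simp only [coneIntegral, Pi.one_apply]
  rw [← h_scale, ← integral_mul_const, ← integral_const_mul]
  congr 1
  ext y
  have hρ := coneDist_pos one_pos y
  rw [coneDist_smul hε.le, Prod.smul_mk, smul_eq_mul, mul_pow]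
  field_simp
  ring

theorem tendsto_pow_mul_coneIntegral {m : ℕ} (hm : 0 < m) (hχ : Continuous χ)
    (hχc : HasCompactSupport χ) (w : E × ℝ) :
    Tendsto (fun ε => ε ^ m * coneIntegral ε w (finrank ℝ E + m) 1 χ) (𝓝[>] 0)
      (𝓝 ((∫ y : E, (coneDist 1 y ^ (finrank ℝ E + m))⁻¹) * χ w)) := by
  obtain ⟨C, hC⟩ := hχ.bounded_above_of_compact_support hχc
  have h_kernel := integrable_inv_coneDist_one_pow (E := E) (k := finrank ℝ E + m) (by omega)
  have hρ := continuous_coneDist_right (E := E) 1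
  rw [← integral_mul_const]
  refine Tendsto.congr' (f₁ := fun ε => ∫ y : E, (coneDist 1 y ^ (finrank ℝ E + m))⁻¹ *
    χ (w + ε • (y, coneDist 1 y))) ?_ ?_
  · filter_upwards [self_mem_nhdsWithin] with ε hε
    exact (pow_mul_coneIntegral_eq hε w χ m).symm
  · refine tendsto_integral_filter_of_dominated_convergence _ (.of_forall fun ε => ?_)
      (.of_forall fun ε => .of_forall fun y => ?_) (h_kernel.mul_const C) (.of_forall fun y => ?_)
    · exact h_kernel.aestronglyMeasurable.mul (by fun_prop)
    · have := coneDist_pos one_pos y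
      rw [norm_mul, Real.norm_of_nonneg (by positivity)]
      gcongr
      exact hC _
    · have h_cont : Continuous fun ε : ℝ =>
        (coneDist 1 y ^ (finrank ℝ E + m))⁻¹ * χ (w + ε • (y, coneDist 1 y)) := by fun_prop
      simpa using (h_cont.tendsto 0).mono_left nhdsWithin_le_nhds

variable (E) in
/-- The measure `‖y‖⁻ᵏ dy` on the backward light cone with vertex `0`. Convolving with it turns a
function into its integral over the forward light cone. -/
def lightConeMeasure (k : ℕ) : Measure (E × ℝ) :=
  (volume.withDensity fun y : E => ENNReal.ofReal (‖y‖ ^ k)⁻¹).map fun y => (-y, -‖y‖)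

theorem isLocallyFiniteMeasure_lightConeMeasure (hk : k < finrank ℝ E) :
    IsLocallyFiniteMeasure (lightConeMeasure E k) := by
  refine ⟨fun z => ⟨Metric.ball 0 (‖z‖ + 1), Metric.isOpen_ball.mem_nhds (by simp), ?_⟩⟩
  have h_preimage : (fun y : E => ((-y, -‖y‖) : E × ℝ)) ⁻¹' Metric.ball 0 (‖z‖ + 1) =
      Metric.ball 0 (‖z‖ + 1) := by
    ext y
    simp [Prod.norm_def]
  have h_int : IntegrableOn (fun y : E => (‖y‖ ^ k)⁻¹) (Metric.ball 0 (‖z‖ + 1)) :=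
    ((locallyIntegrable_inv_norm_pow hk).integrableOn_isCompact
      (isCompact_closedBall 0 _)).mono_set Metric.ball_subset_closedBall
  rw [lightConeMeasure, Measure.map_apply (by fun_prop) measurableSet_ball, h_preimage,
    withDensity_apply _ measurableSet_ball]
  exact (hasFiniteIntegral_iff_ofReal (.of_forall fun y => by positivity)).1 h_int.2

theorem coneIntegral_zero_eq_convolution (hχ : Continuous χ) (k : ℕ) (w : E × ℝ) :
    coneIntegral 0 w k 1 χ =
      ((fun _ => (1 : ℝ)) ⋆[ContinuousLinearMap.mul ℝ ℝ, lightConeMeasure E k] χ) w := by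
  simp only [convolution_def, ContinuousLinearMap.mul_apply', one_mul]
  rw [lightConeMeasure, integral_map (by fun_prop) (by fun_prop),
    integral_withDensity_eq_integral_toReal_smul (by fun_prop)
      (.of_forall fun y => ENNReal.ofReal_lt_top)]
  refine integral_congr_ae (.of_forall fun y => ?_)
  have h_sub : w - (-y, -‖y‖) = w + (y, ‖y‖) := by rw [sub_eq_add_neg]; simp
  have h_toReal : (ENNReal.ofReal (‖y‖ ^ k)⁻¹).toReal = (‖y‖ ^ k)⁻¹ :=
    ENNReal.toReal_ofReal (by positivity)
  simp only [coneDist_zero, h_sub, h_toReal, Pi.one_apply, one_div, smul_eq_mul]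

theorem contDiff_coneIntegral_zero {n : ℕ∞} (hk : k < finrank ℝ E) (hχ : ContDiff ℝ n χ)
    (hχc : HasCompactSupport χ) : ContDiff ℝ n fun w => coneIntegral 0 w k 1 χ := by
  have := isLocallyFiniteMeasure_lightConeMeasure hk
  simp only [coneIntegral_zero_eq_convolution hχ.continuous]
  exact hχc.contDiff_convolution_right _ (locallyIntegrable_const 1) hχ

theorem fderiv_coneIntegral_zero (hk : k < finrank ℝ E) (hχ : ContDiff ℝ 1 χ)
    (hχc : HasCompactSupport χ) (w v : E × ℝ) :
    fderiv ℝ (fun w => coneIntegral 0 w k 1 χ) w v =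
      coneIntegral 0 w k 1 fun z => fderiv ℝ χ z v := by
  have := isLocallyFiniteMeasure_lightConeMeasure hk
  have hχ' := hχ.continuous_fderiv one_ne_zero
  simp only [coneIntegral_zero_eq_convolution hχ.continuous,
    coneIntegral_zero_eq_convolution (hχ'.clm_apply continuous_const)]
  have h_snd (z : E × ℝ) : fderiv ℝ (fun q : ℝ × (E × ℝ) => χ q.2) (0, z) =
      (fderiv ℝ χ z).comp (ContinuousLinearMap.snd ℝ ℝ (E × ℝ)) :=
    ((hχ.differentiable one_ne_zero z).hasFDerivAt.comp (0, z) hasFDerivAt_snd).fderiv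
  have h_support : HasCompactSupport fun z =>
      (fderiv ℝ χ z).comp (ContinuousLinearMap.snd ℝ ℝ (E × ℝ)) :=
    (hχc.fderiv ℝ).comp_left
      (g := fun A : (E × ℝ) →L[ℝ] ℝ => A.comp (ContinuousLinearMap.snd ℝ ℝ (E × ℝ)))
      (ContinuousLinearMap.zero_comp _)
  -- `lightConeMeasure` is not translation invariant, as `hasFDerivAt_convolution_right` would need;
  -- the version with a (dummy) parameter has no such assumption.
  have h_param := (hasFDerivAt_convolution_right_with_param (ContinuousLinearMap.mul ℝ ℝ)
    (μ := lightConeMeasure E k) (f := fun _ => 1) (g := fun _ : ℝ => χ) isOpen_univ hχc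
    (fun _ _ _ hx => image_eq_zero_of_notMem_tsupport hx) (locallyIntegrable_const 1)
    (hχ.comp contDiff_snd).contDiffOn (0, w) (mem_univ _)).comp w (hasFDerivAt_prodMk_right 0 w)
  have h_fderiv := congrArg (· v) h_param.fderiv
  simp only [Function.HasUncurry.uncurry, id, h_snd, ContinuousLinearMap.comp_apply] at h_fderiv
  rw [convolution_precompR_apply _ (locallyIntegrable_const 1) h_support
    (by fun_prop)] at h_fderiv
  simpa [Function.comp_def] using h_fderiv

theorem coneIntegral_zero_eq_zero {R T : ℝ} (hχ : ∀ z, R ≤ ‖z‖ → χ z = 0) (hT : -T ≤ w.2)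
    (hw : 2 * R + T ≤ ‖w‖) : coneIntegral 0 w k q χ = 0 := by
  have h_vanish (y : E) : χ (w + (y, ‖y‖)) = 0 := by
    refine hχ _ (le_of_not_gt fun h_lt => hw.not_gt ?_)
    have h_space : ‖w.1 + y‖ < R := (norm_fst_le _).trans_lt h_lt
    have h_time : |w.2 + ‖y‖| < R := (norm_snd_le _).trans_lt h_lt
    have h_tri : ‖w.1‖ ≤ ‖w.1 + y‖ + ‖y‖ := by simpa using norm_sub_le (w.1 + y) y
    have hy := norm_nonneg y
    have h_time' := abs_lt.1 h_time
    rw [Prod.norm_def, max_lt_iff, Real.norm_eq_abs, abs_lt]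
    refine ⟨?_, ?_, ?_⟩ <;> linarith
  simp [coneIntegral, coneDist_zero, h_vanish]

end Cone

/-- Smooth compactly supported functions on space-time. -/
abbrev SpaceTimeTestFunction : Type := 𝓓((⊤ : Opens SpaceTime), ℝ)

/-- The d'Alembert operator `∂_tt - Δ_x` on test functions. -/
def waveOperator (ψ : SpaceTimeTestFunction) : SpaceTimeTestFunction :=
  ∂_{timeDir} (∂_{timeDir} ψ) - ∑ i : Fin 3, ∂_{spaceDir i} (∂_{spaceDir i} ψ)

theorem dAlembertian_apply (p : SpaceTimeDistribution) (ψ : SpaceTimeTestFunction) :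
    dAlembertian p ψ = p (waveOperator ψ) := by
  have second_deriv (v : SpaceTime) : (∂_{v} (∂_{v} p)) ψ = p (∂_{v} (∂_{v} ψ)) := by simp
  simp only [waveOperator, map_sub, map_sum, ← second_deriv]
  simp [dAlembertian]

theorem coneIntegral_spaceDir {ε : ℝ} (hε : 0 < ε) (w : SpaceTime) (k : ℕ) {q : Space → ℝ}
    (hq : ContDiff ℝ 1 q) (ψ : SpaceTimeTestFunction) (i : Fin 3) :
    coneIntegral ε w k q (∂_{spaceDir i} ψ : SpaceTimeTestFunction) =
      k * coneIntegral ε w (k + 2) (fun y => q y * y i) ψ -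
        coneIntegral ε w k (fun y => fderiv ℝ q y (EuclideanSpace.single i 1)) ψ -
        coneIntegral ε w (k + 1) (fun y => q y * y i) (∂_{timeDir} ψ : SpaceTimeTestFunction) := by
  simpa only [coe_lineDerivOp, spaceDir, timeDir, EuclideanSpace.inner_single_right, one_mul,
    conj_trivial] using coneIntegral_fderiv_space (w := w) (k := k) hε hq
      (ψ.contDiff.of_le (by simp)) ψ.hasCompactSupport (EuclideanSpace.single i 1)

theorem coneIntegral_spaceDir_spaceDir {ε : ℝ} (hε : 0 < ε) (w : SpaceTime)
    (ψ : SpaceTimeTestFunction) (i : Fin 3) :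
    coneIntegral ε w 1 1 (∂_{spaceDir i} (∂_{spaceDir i} ψ) : SpaceTimeTestFunction) =
      3 * coneIntegral ε w 5 (fun y => y i ^ 2) ψ - coneIntegral ε w 3 1 ψ -
        3 * coneIntegral ε w 4 (fun y => y i ^ 2) (∂_{timeDir} ψ : SpaceTimeTestFunction) +
        coneIntegral ε w 2 1 (∂_{timeDir} ψ : SpaceTimeTestFunction) +
        coneIntegral ε w 3 (fun y => y i ^ 2)
          (∂_{timeDir} (∂_{timeDir} ψ) : SpaceTimeTestFunction) := by
  have h_coord : ContDiff ℝ 1 fun y : Space => y i := by fun_prop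
  have h_weight (k : ℕ) (χ : SpaceTimeTestFunction) :
      coneIntegral ε w k (fun y => y i) (∂_{spaceDir i} χ : SpaceTimeTestFunction) =
        k * coneIntegral ε w (k + 2) (fun y => y i ^ 2) χ - coneIntegral ε w k 1 χ -
          coneIntegral ε w (k + 1) (fun y => y i ^ 2)
            (∂_{timeDir} χ : SpaceTimeTestFunction) := by
    have h_fderiv (y : Space) :
        fderiv ℝ (fun y : Space => y i) y (EuclideanSpace.single i 1) = 1 := by
      have h_proj : fderiv ℝ (fun y : Space => y i) y = EuclideanSpace.proj i :=
        (EuclideanSpace.proj i : Space →L[ℝ] ℝ).fderiv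
      simp [h_proj]
    rw [coneIntegral_spaceDir hε w k h_coord]
    simp only [h_fderiv, ← sq, Pi.one_def]
  have h_unit := coneIntegral_spaceDir hε w 1 (q := 1) contDiff_const (∂_{spaceDir i} ψ) i
  have h_fderiv_one :
      (fun y : Space => fderiv ℝ 1 y (EuclideanSpace.single i 1)) = (0 : Space → ℝ) := by
    ext y
    simp
  have h_zero : coneIntegral ε w 1 0 (∂_{spaceDir i} ψ : SpaceTimeTestFunction) = 0 := by
    simp [coneIntegral]
  simp only [Nat.reduceAdd, Pi.one_apply, one_mul, lineDerivOp_comm ψ timeDir (spaceDir i),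
    h_weight, h_fderiv_one] at h_unit
  rw [h_unit, h_zero]
  push_cast
  ring

theorem coneIntegral_waveOperator_of_integrable {ε : ℝ} {w : SpaceTime} {k : ℕ} {q : Space → ℝ}
    (h_int : ∀ χ : SpaceTimeTestFunction,
      Integrable fun y => q y / coneDist ε y ^ k * χ (w + (y, coneDist ε y)))
    (ψ : SpaceTimeTestFunction) :
    coneIntegral ε w k q (waveOperator ψ) =
      coneIntegral ε w k q (∂_{timeDir} (∂_{timeDir} ψ) : SpaceTimeTestFunction) -
        ∑ i : Fin 3,
          coneIntegral ε w k q (∂_{spaceDir i} (∂_{spaceDir i} ψ) : SpaceTimeTestFunction) := by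
  simp only [coneIntegral, waveOperator, FunLike.coe_sub, FunLike.coe_sum, Pi.sub_apply,
    Finset.sum_apply, mul_sub, Finset.mul_sum]
  rw [integral_sub (h_int _) (integrable_finsetSum _ fun i _ => h_int _),
    integral_finsetSum _ fun i _ => h_int _]

theorem coneIntegral_waveOperator {ε : ℝ} (hε : 0 < ε) (w : SpaceTime)
    (ψ : SpaceTimeTestFunction) :
    coneIntegral ε w 1 1 (waveOperator ψ) =
      ε ^ 2 * coneIntegral ε w 3 1 (∂_{timeDir} (∂_{timeDir} ψ) : SpaceTimeTestFunction) -
        3 * (ε ^ 2 * coneIntegral ε w 4 1 (∂_{timeDir} ψ : SpaceTimeTestFunction)) +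
        3 * (ε ^ 2 * coneIntegral ε w 5 1 ψ) := by
  have h_sum_sq (k : ℕ) (χ : SpaceTimeTestFunction) :
      ∑ i : Fin 3, coneIntegral ε w (k + 2) (fun y => y i ^ 2) χ =
        coneIntegral ε w k 1 χ - ε ^ 2 * coneIntegral ε w (k + 2) 1 χ := by
    rw [← coneIntegral_norm_sq hε χ.continuous χ.hasCompactSupport, ← coneIntegral_sum_weight hε
      (fun i _ => by fun_prop) χ.continuous χ.hasCompactSupport]
    simp only [EuclideanSpace.norm_sq_eq, Real.norm_eq_abs, sq_abs]
  rw [coneIntegral_waveOperator_of_integrable fun χ =>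
    integrable_coneIntegral hε continuous_one χ.continuous χ.hasCompactSupport]
  simp only [coneIntegral_spaceDir_spaceDir hε, Finset.sum_add_distrib, Finset.sum_sub_distrib,
    ← Finset.mul_sum, h_sum_sq, Finset.sum_const, Finset.card_univ, Fintype.card_fin, nsmul_eq_mul]
  ring

theorem integral_inv_coneDist_one_pow_five :
    3 * ∫ y : Space, (coneDist 1 y ^ 5)⁻¹ = 4 * Real.pi := by
  have h_finrank : finrank ℝ Space = 3 := by simp
  have h_radial := integral_fun_norm_addHaar (volume : Measure Space)
    fun r : ℝ => (√(1 ^ 2 + r ^ 2) ^ 5)⁻¹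
  have h_int := (integrable_fun_norm_addHaar (volume : Measure Space)
    (f := fun r : ℝ => (√(1 ^ 2 + r ^ 2) ^ 5)⁻¹)).1
    (integrable_inv_coneDist_one_pow (by simp))
  have h_deriv (r : ℝ) : HasDerivAt (fun r => Real.sin (Real.arctan r) ^ 3 / 3)
      (r ^ 2 * (√(1 ^ 2 + r ^ 2) ^ 5)⁻¹) r := by
    refine (((Real.hasDerivAt_arctan r).sin.pow 3).div_const 3).congr_deriv ?_
    have h_sq : √(1 + r ^ 2) ^ 2 = 1 + r ^ 2 := Real.sq_sqrt (by positivity)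
    have : 0 < √(1 + r ^ 2) := by positivity
    rw [Real.cos_arctan, Real.sin_arctan, one_pow, ← h_sq]
    norm_num
    field_simp
  have h_lim : Tendsto (fun r => Real.sin (Real.arctan r) ^ 3 / 3) atTop (𝓝 (1 / 3)) := by
    have h_sin := (Real.continuous_sin.tendsto _).comp
      (Real.tendsto_arctan_atTop.mono_right nhdsWithin_le_nhds)
    simpa using (h_sin.pow 3).div_const 3
  have h_vol : volume.real (Metric.ball (0 : Space) 1) = Real.pi * 4 / 3 := by
    rw [Measure.real, EuclideanSpace.volume_ball_fin_three]
    simp [ENNReal.toReal_ofReal (show 0 ≤ Real.pi * 4 / 3 by positivity)]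
  simp only [h_finrank, Nat.add_one_sub_one, smul_eq_mul, nsmul_eq_mul] at h_radial h_int
  rw [integral_Ioi_of_hasDerivAt_of_tendsto' (fun r _ => h_deriv r) h_int h_lim, h_vol] at h_radial
  simp only [coneDist, h_radial, Real.arctan_zero, Real.sin_zero]
  push_cast
  ring

theorem coneIntegral_zero_waveOperator (ψ : SpaceTimeTestFunction) (w : SpaceTime) :
    coneIntegral 0 w 1 1 (waveOperator ψ) = 4 * Real.pi * ψ w := by
  have h_finrank : finrank ℝ Space = 3 := by simp
  have h_left := tendsto_coneIntegral (q := 1) (j := 0) (m := 1) (by simp) continuous_one (by simp)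
    (waveOperator ψ).continuous (waveOperator ψ).hasCompactSupport w
  have h_small (k : ℕ) (hk : k < 3) (χ : SpaceTimeTestFunction) :=
    tendsto_sq_mul_coneIntegral (k := k) (by simpa using hk) χ.continuous χ.hasCompactSupport w
  have h_dirac := tendsto_pow_mul_coneIntegral two_pos ψ.continuous ψ.hasCompactSupport w
  simp only [h_finrank, Nat.reduceAdd] at h_dirac
  have h_right := ((h_small 1 (by simp) (∂_{timeDir} (∂_{timeDir} ψ))).sub
    ((h_small 2 (by simp) (∂_{timeDir} ψ)).const_mul 3)).add (h_dirac.const_mul 3)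
  have h_eq := tendsto_nhds_unique h_left (h_right.congr' (by
    filter_upwards [self_mem_nhdsWithin] with ε hε
    exact (coneIntegral_waveOperator hε w ψ).symm))
  rw [add_zero] at h_eq
  rw [h_eq, ← integral_inv_coneDist_one_pow_five]
  ring

/-- The advanced potential `(4π)⁻¹ ∫ |y|⁻¹ ψ(x + y, t + |y|) dy`, which solves the wave equation
with source `ψ` backwards in time. -/
def advancedPotential (ψ : SpaceTime → ℝ) (w : SpaceTime) : ℝ :=
  (4 * Real.pi)⁻¹ * coneIntegral 0 w 1 1 ψ

theorem contDiff_advancedPotential (ψ : SpaceTimeTestFunction) :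
    ContDiff ℝ ∞ (advancedPotential ψ) :=
  contDiff_const.mul (contDiff_coneIntegral_zero (by simp) ψ.contDiff ψ.hasCompactSupport)

theorem fderiv_advancedPotential (ψ : SpaceTimeTestFunction) (w v : SpaceTime) :
    fderiv ℝ (advancedPotential ψ) w v =
      advancedPotential (∂_{v} ψ : SpaceTimeTestFunction) w := by
  have h_diff : Differentiable ℝ fun w => coneIntegral 0 w 1 1 ψ :=
    (contDiff_coneIntegral_zero (by simp) ψ.contDiff ψ.hasCompactSupport).differentiable (by simp)
  unfold advancedPotential
  rw [fderiv_const_mul (h_diff w), smul_apply, smul_eq_mul,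
    fderiv_coneIntegral_zero (by simp) (ψ.contDiff.of_le (by simp)) ψ.hasCompactSupport,
    coe_lineDerivOp]

theorem advancedPotential_waveOperator (ψ : SpaceTimeTestFunction) (w : SpaceTime) :
    advancedPotential (waveOperator ψ) w = ψ w := by
  rw [advancedPotential, coneIntegral_zero_waveOperator, inv_mul_cancel_left₀ (by positivity)]

theorem advancedPotential_waveOperator_expand (ψ : SpaceTimeTestFunction) (w : SpaceTime) :
    advancedPotential (waveOperator ψ) w =
      advancedPotential (∂_{timeDir} (∂_{timeDir} ψ) : SpaceTimeTestFunction) w -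
        ∑ i : Fin 3,
          advancedPotential (∂_{spaceDir i} (∂_{spaceDir i} ψ) : SpaceTimeTestFunction) w := by
  simp only [advancedPotential, ← Finset.mul_sum, ← mul_sub]
  rw [coneIntegral_waveOperator_of_integrable fun χ =>
    integrable_coneIntegral_zero (by simp) χ.continuous χ.hasCompactSupport w]

/-- The advanced potential of `ψ`, smoothly cut off at times between `-2` and `-1` to become a test
function. -/
def cutoffPotential (ψ : SpaceTimeTestFunction) : SpaceTimeTestFunction where
  toFun w := Real.smoothTransition (w.2 + 2) * advancedPotential ψ w
  contDiff' := (Real.smoothTransition.contDiff.comp (by fun_prop)).mul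
    (contDiff_advancedPotential ψ)
  hasCompactSupport' := by
    obtain ⟨R, -, hR⟩ := ψ.hasCompactSupport.exists_pos_le_norm
    refine HasCompactSupport.intro (isCompact_closedBall 0 (2 * R + 2)) fun w hw => ?_
    rcases le_total w.2 (-2) with ht | ht
    · rw [Real.smoothTransition.zero_of_nonpos (by linarith), zero_mul]
    · have hw' : 2 * R + 2 < ‖w‖ := by simpa using hw
      rw [advancedPotential, coneIntegral_zero_eq_zero hR ht hw'.le, mul_zero, mul_zero]
  tsupport_subset' := subset_univ _

theorem cutoffPotential_eqOn (ψ : SpaceTimeTestFunction) :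
    EqOn (cutoffPotential ψ) (advancedPotential ψ) {w | -1 < w.2} := fun w hw => by
  have hw' : -1 < w.2 := hw
  change Real.smoothTransition (w.2 + 2) * advancedPotential ψ w = _
  rw [Real.smoothTransition.one_of_one_le (by linarith), one_mul]

theorem lineDerivOp_eqOn_advancedPotential {Φ ψ : SpaceTimeTestFunction} {O : Set SpaceTime}
    (hO : IsOpen O) (h : EqOn Φ (advancedPotential ψ) O) (v : SpaceTime) :
    EqOn (∂_{v} Φ : SpaceTimeTestFunction)
      (advancedPotential (∂_{v} ψ : SpaceTimeTestFunction)) O := fun w hw => by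
  rw [← fderiv_advancedPotential, ← (h.eventuallyEq_of_mem (hO.mem_nhds hw)).fderiv_eq,
    coe_lineDerivOp]

theorem lineDerivOp_cutoffPotential_eqOn (ψ : SpaceTimeTestFunction) (v : SpaceTime) :
    EqOn (∂_{v} (cutoffPotential ψ) : SpaceTimeTestFunction)
      (advancedPotential (∂_{v} ψ : SpaceTimeTestFunction)) {w | -1 < w.2} :=
  lineDerivOp_eqOn_advancedPotential (isOpen_lt continuous_const continuous_snd)
    (cutoffPotential_eqOn ψ) v

theorem waveOperator_cutoffPotential_eqOn (ψ : SpaceTimeTestFunction) :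
    EqOn (waveOperator (cutoffPotential ψ)) ψ {w | -1 < w.2} := fun w hw => by
  have h_second (v : SpaceTime) := lineDerivOp_eqOn_advancedPotential
    (isOpen_lt continuous_const continuous_snd) (lineDerivOp_cutoffPotential_eqOn ψ v) v hw
  rw [← advancedPotential_waveOperator ψ w, advancedPotential_waveOperator_expand]
  simp only [waveOperator, FunLike.coe_sub, FunLike.coe_sum, Pi.sub_apply, Finset.sum_apply,
    h_second]

theorem IsPressureWave.apply_eq_neg_sheet {f : Plane → ℝ} {p : SpaceTimeDistribution}
    (hp : IsPressureWave f p) (ψ : SpaceTimeTestFunction) :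
    p ψ = -sheet f fun x => advancedPotential (∂_{timeDir} ψ : SpaceTimeTestFunction) (x, 0) := by
  set Φ := cutoffPotential ψ
  have h_past : p (waveOperator Φ - ψ) = 0 := by
    have h_support : tsupport (waveOperator Φ - ψ) ⊆ {y : SpaceTime | y.2 ≤ -1} := by
      refine closure_minimal (fun w hw => le_of_not_gt (α := ℝ) fun h_lt => hw ?_)
        (isClosed_le continuous_snd continuous_const)
      rw [FunLike.coe_sub, Pi.sub_apply, waveOperator_cutoffPotential_eqOn ψ h_lt, sub_self]
    refine hp.eq_zero_of_neg _ (h_support.trans fun w (hw : w.2 ≤ -1) => ?_)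
    exact hw.trans_lt (by norm_num)
  rw [map_sub, sub_eq_zero, ← dAlembertian_apply, hp.wave_eq Φ] at h_past
  rw [← h_past]
  congr 2
  ext x
  have h_time : (x, (0 : ℝ)) ∈ {w : SpaceTime | -1 < w.2} := by simp
  exact lineDerivOp_cutoffPotential_eqOn ψ timeDir h_time

section SphericalMean

theorem integral_eq_integral_Ioi_toSphere {E F : Type*} [NormedAddCommGroup E] [NormedSpace ℝ E]
    [FiniteDimensional ℝ E] [Nontrivial E] [MeasurableSpace E] [BorelSpace E] (μ : Measure E)
    [μ.IsAddHaarMeasure] [NormedAddCommGroup F] [NormedSpace ℝ F] {g : E → F}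
    (hg : Integrable g μ) :
    ∫ y, g y ∂μ = ∫ r in Ioi (0 : ℝ), r ^ (finrank ℝ E - 1) •
      ∫ θ : Metric.sphere (0 : E) 1, g (r • (θ : E)) ∂μ.toSphere := by
  have h_polar := μ.measurePreserving_homeomorphUnitSphereProd
  have h_emb := (homeomorphUnitSphereProd E).measurableEmbedding
  set G : Metric.sphere (0 : E) 1 × Ioi (0 : ℝ) → F := fun q => g ((q.2 : ℝ) • (q.1 : E))
  have hG (x : ({0}ᶜ : Set E)) : G (homeomorphUnitSphereProd E x) = g x :=
    congrArg (g ∘ Subtype.val) ((homeomorphUnitSphereProd E).symm_apply_apply x)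
  have h_eq : ∫ y, g y ∂μ = ∫ q, G q ∂μ.toSphere.prod (.volumeIoiPow (finrank ℝ E - 1)) := by
    rw [← h_polar.integral_comp h_emb]
    simp only [hG]
    rw [integral_subtype_comap (measurableSet_singleton (0 : E)).compl g, restrict_compl_singleton]
  have hG_int : Integrable G (μ.toSphere.prod (.volumeIoiPow (finrank ℝ E - 1))) := by
    rw [← h_polar.integrable_comp_emb h_emb,
      show G ∘ homeomorphUnitSphereProd E = g ∘ Subtype.val from funext hG]
    exact (integrableOn_iff_comap_subtypeVal (measurableSet_singleton (0 : E)).compl).1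
      hg.integrableOn
  rw [h_eq, integral_prod_symm _ hG_int]
  simp only [Measure.volumeIoiPow, ENNReal.ofReal]
  rw [integral_withDensity_eq_integral_smul (measurable_subtype_coe.pow_const _).real_toNNReal,
    integral_subtype_comap measurableSet_Ioi fun a : ℝ => Real.toNNReal (a ^ (finrank ℝ E - 1)) •
      ∫ θ : Metric.sphere (0 : E) 1, g (a • (θ : E)) ∂μ.toSphere]
  refine setIntegral_congr_fun measurableSet_Ioi fun r hr => ?_
  simp only [NNReal.smul_def, Real.coe_toNNReal _ (pow_nonneg (le_of_lt hr) _)]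

variable {n : ℕ} {f : EuclideanSpace ℝ (Fin n) → ℝ}

theorem toSphere_real_univ_ne_zero [NeZero n] :
    (volume : Measure (EuclideanSpace ℝ (Fin n))).toSphere.real univ ≠ 0 := by
  rw [measureReal_ne_zero_iff, Measure.measure_univ_ne_zero]
  exact Measure.toSphere_ne_zero _

theorem integral_mul_comp_norm_sub_eq_sphericalMean [NeZero n] {K : ℝ → ℝ}
    (x : EuclideanSpace ℝ (Fin n)) (hfK : Integrable fun y => f y * K ‖y - x‖) :
    ∫ y, f y * K ‖y - x‖ =
      (volume : Measure (EuclideanSpace ℝ (Fin n))).toSphere.real univ *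
        ∫ r in Ioi (0 : ℝ), r ^ (n - 1) * (sphericalMean f x r * K r) := by
  have h_shift : Integrable fun y => f (x + y) * K ‖y‖ := by
    simpa only [add_sub_cancel_left] using hfK.comp_add_left x
  rw [← integral_add_left_eq_self (fun y => f y * K ‖y - x‖) x, ← integral_const_mul]
  simp only [add_sub_cancel_left]
  rw [integral_eq_integral_Ioi_toSphere volume h_shift, finrank_euclideanSpace_fin]
  refine setIntegral_congr_fun measurableSet_Ioi fun r (hr : 0 < r) => ?_
  have h_norm (θ : Metric.sphere (0 : EuclideanSpace ℝ (Fin n)) 1) :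
      ‖r • (θ : EuclideanSpace ℝ (Fin n))‖ = r := by
    rw [norm_smul, norm_eq_of_mem_sphere, mul_one, Real.norm_of_nonneg hr.le]
  simp only [h_norm, integral_mul_const, sphericalMean, smul_eq_mul]
  have h_area := toSphere_real_univ_ne_zero (n := n)
  field_simp

theorem sphericalMean_zero [NeZero n] (f : EuclideanSpace ℝ (Fin n) → ℝ)
    (x : EuclideanSpace ℝ (Fin n)) : sphericalMean f x 0 = f x := by
  simp only [sphericalMean, zero_smul, add_zero, integral_const, smul_eq_mul]
  rw [inv_mul_cancel_left₀ toSphere_real_univ_ne_zero]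

/-- The radial derivative `|S^{n-1}|⁻¹ ∫_{S^{n-1}} θ · ∇f (x + r θ) ds(θ)` of the spherical mean. -/
def sphericalMeanDeriv (f : EuclideanSpace ℝ (Fin n) → ℝ) (x : EuclideanSpace ℝ (Fin n))
    (r : ℝ) : ℝ :=
  ((volume : Measure (EuclideanSpace ℝ (Fin n))).toSphere.real univ)⁻¹ *
    ∫ θ : Metric.sphere (0 : EuclideanSpace ℝ (Fin n)) 1,
      fderiv ℝ f (x + r • (θ : EuclideanSpace ℝ (Fin n))) θ
        ∂(volume : Measure (EuclideanSpace ℝ (Fin n))).toSphere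

theorem continuous_sphericalMean (hf : Continuous f) :
    Continuous fun a : EuclideanSpace ℝ (Fin n) × ℝ => sphericalMean f a.1 a.2 := by
  have h_int := continuous_parametric_integral_of_continuous
    (μ := (volume : Measure (EuclideanSpace ℝ (Fin n))).toSphere)
    (f := fun (a : EuclideanSpace ℝ (Fin n) × ℝ) (θ : Metric.sphere 0 1) =>
      f (a.1 + a.2 • (θ : EuclideanSpace ℝ (Fin n)))) (by fun_prop) isCompact_univ
  exact continuous_const.mul (by simpa only [Measure.restrict_univ] using h_int)

theorem continuous_sphericalMeanDeriv (hf : ContDiff ℝ 1 f) :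
    Continuous fun a : EuclideanSpace ℝ (Fin n) × ℝ => sphericalMeanDeriv f a.1 a.2 := by
  have hf' := hf.continuous_fderiv one_ne_zero
  have h_int := continuous_parametric_integral_of_continuous
    (μ := (volume : Measure (EuclideanSpace ℝ (Fin n))).toSphere)
    (f := fun (a : EuclideanSpace ℝ (Fin n) × ℝ)
        (θ : Metric.sphere (0 : EuclideanSpace ℝ (Fin n)) 1) =>
      fderiv ℝ f (a.1 + a.2 • (θ : EuclideanSpace ℝ (Fin n))) θ)
    ((hf'.comp (by fun_prop)).clm_apply (by fun_prop)) isCompact_univ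
  exact continuous_const.mul (by simpa only [Measure.restrict_univ] using h_int)

theorem hasDerivAt_sphericalMean (hf : ContDiff ℝ 1 f) (x : EuclideanSpace ℝ (Fin n)) (r : ℝ) :
    HasDerivAt (sphericalMean f x) (sphericalMeanDeriv f x r) r := by
  have hf_cont := hf.continuous
  have hf' := hf.continuous_fderiv one_ne_zero
  obtain ⟨C, hC⟩ := (isCompact_closedBall x (|r| + 1)).exists_bound_of_continuousOn
    hf'.continuousOn
  refine (hasDerivAt_integral_of_dominated_loc_of_deriv_le
    (F := fun r (θ : Metric.sphere 0 1) => f (x + r • (θ : EuclideanSpace ℝ (Fin n))))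
    (F' := fun r (θ : Metric.sphere (0 : EuclideanSpace ℝ (Fin n)) 1) =>
      fderiv ℝ f (x + r • (θ : EuclideanSpace ℝ (Fin n))) θ)
    (bound := fun _ => C) (Metric.ball_mem_nhds r one_pos) ?_ ?_ ?_ ?_ (integrable_const C)
    ?_).2.const_mul _
  · exact .of_forall fun s => Continuous.aestronglyMeasurable (by fun_prop)
  · exact Continuous.integrable_of_hasCompactSupport (by fun_prop) (.of_compactSpace _)
  · exact ((hf'.comp (by fun_prop)).clm_apply (by fun_prop)).aestronglyMeasurable
  · refine .of_forall fun θ s hs => ?_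
    have h_mem : x + s • (θ : EuclideanSpace ℝ (Fin n)) ∈ Metric.closedBall x (|r| + 1) := by
      have hs' : |s - r| < 1 := hs
      rw [mem_closedBall_iff_norm, add_sub_cancel_left, norm_smul, norm_eq_of_mem_sphere, mul_one,
        Real.norm_eq_abs]
      linarith [abs_sub_abs_le_abs_sub s r]
    refine ((fderiv ℝ f (x + s • (θ : EuclideanSpace ℝ (Fin n)))).le_opNorm θ).trans ?_
    rw [norm_eq_of_mem_sphere, mul_one]
    exact hC _ h_mem
  · refine .of_forall fun θ s _ => ?_
    have h_ray : HasDerivAt (fun s : ℝ => x + s • (θ : EuclideanSpace ℝ (Fin n))) θ s := by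
      simpa using ((hasDerivAt_id s).smul_const (θ : EuclideanSpace ℝ (Fin n))).const_add x
    exact (hf.differentiable one_ne_zero _).hasFDerivAt.comp_hasDerivAt s h_ray

end SphericalMean

theorem integrable_mul_of_continuousOn_of_tsupport_subset {X : Type*} [TopologicalSpace X]
    [MeasurableSpace X] [OpensMeasurableSpace X] {μ : Measure X} [IsFiniteMeasureOnCompacts μ]
    {U : Set X} {g φ : X → ℝ} (hU : IsOpen U) (hg : ContinuousOn g U) (hφ : Continuous φ)
    (hφc : HasCompactSupport φ) (hφU : tsupport φ ⊆ U) : Integrable (fun x => g x * φ x) μ :=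
  have h_cont : Continuous (g * φ) := (hg.mul hφ.continuousOn).continuous_of_tsupport_subset hU
    ((closure_mono (Function.support_mul_subset_right g φ)).trans hφU)
  h_cont.integrable_of_hasCompactSupport hφc.mul_left

theorem integral_Ioi_mul_deriv_eq_neg {a : ℝ} {u u' v : ℝ → ℝ}
    (hu : ∀ t ∈ Ioi a, HasDerivAt u (u' t) t) (hu' : ContinuousOn u' (Ioi a))
    (hv : ContDiff ℝ 1 v) (hvc : HasCompactSupport v) (hva : tsupport v ⊆ Ioi a) :
    ∫ t in Ioi a, u t * deriv v t = -∫ t in Ioi a, u' t * v t := by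
  have hu_cont : ContinuousOn u (Ioi a) := fun t ht => (hu t ht).continuousAt.continuousWithinAt
  have h_near_a : v =ᶠ[𝓝 a] 0 :=
    notMem_tsupport_iff_eventuallyEq.1 fun ha => self_notMem_Ioi (hva ha)
  have h_near_top : v =ᶠ[atTop] 0 := by
    have h := hasCompactSupport_iff_eventuallyEq.1 hvc
    rw [coclosedCompact_eq_cocompact] at h
    exact h.filter_mono _root_.atTop_le_cocompact
  have h_zero {l : Filter ℝ} (h : v =ᶠ[l] 0) : Tendsto (u * v) l (𝓝 0) :=
    tendsto_const_nhds.congr' (h.mono fun t ht => by simp [ht])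
  rw [integral_Ioi_mul_deriv_eq_deriv_mul hu
    (fun t _ => (hv.differentiable one_ne_zero t).hasDerivAt)
    (integrable_mul_of_continuousOn_of_tsupport_subset isOpen_Ioi hu_cont
      (hv.continuous_deriv le_rfl) hvc.deriv (tsupport_deriv_subset.trans hva)).integrableOn
    (integrable_mul_of_continuousOn_of_tsupport_subset isOpen_Ioi hu' hv.continuous hvc
      hva).integrableOn
    (h_zero (h_near_a.filter_mono nhdsWithin_le_nhds)) (h_zero h_near_top), sub_zero, zero_sub]

theorem hasDerivAt_sqrt_sq_add {c r : ℝ} (h : 0 < r ^ 2 + c) :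
    HasDerivAt (fun r => √(r ^ 2 + c)) (r / √(r ^ 2 + c)) r := by
  refine (((hasDerivAt_pow 2 r).add_const c).sqrt h.ne').congr_deriv ?_
  simp only [Nat.cast_ofNat, Nat.add_one_sub_one, pow_one]
  ring

theorem image_sqrt_sq_add_sq_Ioi (z : ℝ) :
    (fun r : ℝ => √(r ^ 2 + z ^ 2)) '' Ioi 0 = Ioi |z| := by
  ext t
  constructor
  · rintro ⟨r, hr : 0 < r, rfl⟩
    refine Real.lt_sqrt_of_sq_lt ?_
    rw [sq_abs]
    exact lt_add_of_pos_left _ (by positivity)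
  · intro (ht : |z| < t)
    have hz : z ^ 2 < t ^ 2 := sq_lt_sq.2 (ht.trans_le (le_abs_self t))
    refine ⟨√(t ^ 2 - z ^ 2), Real.sqrt_pos.2 (sub_pos.2 hz), ?_⟩
    simp only [Real.sq_sqrt (sub_pos.2 hz).le, sub_add_cancel]
    exact Real.sqrt_sq ((abs_nonneg z).trans ht.le)

theorem integral_Ioi_div_sqrt_mul_comp_sqrt (g : ℝ → ℝ) (z : ℝ) :
    ∫ r in Ioi (0 : ℝ), r / √(r ^ 2 + z ^ 2) * g √(r ^ 2 + z ^ 2) = ∫ t in Ioi |z|, g t := by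
  have h_inj : InjOn (fun r : ℝ => √(r ^ 2 + z ^ 2)) (Ioi 0) :=
    fun r (hr : 0 < r) s (hs : 0 < s) h => by
      rw [Real.sqrt_inj (by positivity) (by positivity), add_left_inj] at h
      exact (pow_left_inj₀ hr.le hs.le two_ne_zero).1 h
  rw [← image_sqrt_sq_add_sq_Ioi, integral_image_eq_integral_abs_deriv_smul measurableSet_Ioi
    (fun r (hr : 0 < r) => (hasDerivAt_sqrt_sq_add (by positivity)).hasDerivWithinAt) h_inj]
  refine setIntegral_congr_fun measurableSet_Ioi fun r (hr : 0 < r) => ?_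
  simp only [abs_of_nonneg (div_nonneg hr.le (Real.sqrt_nonneg _)), smul_eq_mul]

section Layer

theorem toSphere_plane_real_univ :
    (volume : Measure Plane).toSphere.real univ = 2 * Real.pi := by
  rw [Measure.toSphere_real_apply_univ, Measure.real, EuclideanSpace.volume_ball_fin_two]
  simp [Real.pi_nonneg]

/-- The orthogonal projection `(ξ, z) ↦ ξ` of space onto the illumination plane. -/
def planeProj (x : Space) : Plane := !₂[x 0, x 1]

theorem continuous_planeProj : Continuous planeProj := by
  unfold planeProj
  fun_prop

theorem planeProj_spacePoint (ξ : Plane) (z : ℝ) : planeProj (spacePoint ξ z) = ξ := by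
  ext i
  fin_cases i <;> simp [planeProj, spacePoint]

theorem continuous_spacePoint_zero : Continuous fun ξ : Plane => spacePoint ξ 0 := by
  unfold spacePoint
  fun_prop

theorem norm_spacePoint_zero (ξ : Plane) : ‖spacePoint ξ 0‖ = ‖ξ‖ := by
  simp [EuclideanSpace.norm_eq, spacePoint, Fin.sum_univ_three]

theorem norm_sub_spacePoint_zero (x : Space) (ξ : Plane) :
    ‖x - spacePoint ξ 0‖ = √(‖ξ - planeProj x‖ ^ 2 + x 2 ^ 2) := by
  rw [norm_sub_rev ξ, EuclideanSpace.norm_eq, EuclideanSpace.norm_sq_eq, Fin.sum_univ_three,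
    Fin.sum_univ_two]
  simp [spacePoint, planeProj]

variable {f : Plane → ℝ}

theorem integral_mul_comp_norm_sub_spacePoint {g : ℝ → ℝ} (x : Space)
    (h_int : Integrable fun ξ => f ξ * (‖x - spacePoint ξ 0‖⁻¹ * g ‖x - spacePoint ξ 0‖)) :
    ∫ ξ, f ξ * (‖x - spacePoint ξ 0‖⁻¹ * g ‖x - spacePoint ξ 0‖) =
      2 * Real.pi * ∫ t in Ioi |x 2|, sphericalMean f (planeProj x) √(t ^ 2 - x 2 ^ 2) * g t := by
  simp only [norm_sub_spacePoint_zero] at h_int ⊢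
  rw [integral_mul_comp_norm_sub_eq_sphericalMean
    (K := fun r => (√(r ^ 2 + x 2 ^ 2))⁻¹ * g √(r ^ 2 + x 2 ^ 2)) _ h_int,
    toSphere_plane_real_univ, ← integral_Ioi_div_sqrt_mul_comp_sqrt]
  congr 1
  refine setIntegral_congr_fun measurableSet_Ioi fun r (hr : 0 < r) => ?_
  have h_cancel : √(√(r ^ 2 + x 2 ^ 2) ^ 2 - x 2 ^ 2) = r := by
    rw [Real.sq_sqrt (by positivity), add_sub_cancel_right, Real.sqrt_sq hr.le]
  simp only [h_cancel]
  ring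

/-- The space-time points `(x, t)` with `t` greater than the distance of `x` from the illumination
plane. -/
def coneInterior : Set SpaceTime := {w | |w.1 2| < w.2}

theorem isOpen_coneInterior : IsOpen coneInterior :=
  isOpen_lt (by fun_prop) (by fun_prop)

/-- The density of the pressure wave on `coneInterior`: half the time derivative of the circular
mean `M₂[f](ξ; √(t² - z²))`. -/
def waveDensity (f : Plane → ℝ) (w : SpaceTime) : ℝ :=
  2⁻¹ * (sphericalMeanDeriv f (planeProj w.1) √(w.2 ^ 2 - w.1 2 ^ 2) *
    (w.2 / √(w.2 ^ 2 - w.1 2 ^ 2)))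

theorem sq_sub_sq_pos_of_mem_coneInterior {w : SpaceTime} (hw : w ∈ coneInterior) :
    0 < w.2 ^ 2 - w.1 2 ^ 2 :=
  sub_pos.2 (sq_lt_sq.2 (lt_of_lt_of_le hw (le_abs_self w.2)))

theorem continuousOn_waveDensity (hf : ContDiff ℝ 1 f) :
    ContinuousOn (waveDensity f) coneInterior := by
  have h_radius : Continuous fun w : SpaceTime => √(w.2 ^ 2 - w.1 2 ^ 2) := by fun_prop
  refine continuousOn_const.mul (ContinuousOn.mul ?_ ?_)
  · exact ((continuous_sphericalMeanDeriv hf).comp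
      ((continuous_planeProj.comp continuous_fst).prodMk h_radius)).continuousOn
  · exact continuous_snd.continuousOn.div h_radius.continuousOn fun w hw =>
      (Real.sqrt_pos.2 (sq_sub_sq_pos_of_mem_coneInterior hw)).ne'

theorem hasDerivAt_sphericalMean_sqrt (hf : ContDiff ℝ 1 f) {x : Space} {t : ℝ}
    (h : (x, t) ∈ coneInterior) :
    HasDerivAt (fun t => sphericalMean f (planeProj x) √(t ^ 2 - x 2 ^ 2))
      (2 * waveDensity f (x, t)) t := by
  refine ((hasDerivAt_sphericalMean hf _ _).comp t
    (hasDerivAt_sqrt_sq_add (sq_sub_sq_pos_of_mem_coneInterior h))).congr_deriv ?_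
  simp only [waveDensity, mul_inv_cancel_left₀ (two_ne_zero' ℝ), sub_eq_add_neg]

theorem integral_sphericalMean_mul_lineDerivOp_timeDir (hf : ContDiff ℝ 1 f)
    {ψ : SpaceTimeTestFunction} (hψ : tsupport ψ ⊆ coneInterior) (x : Space) :
    ∫ t in Ioi |x 2|, sphericalMean f (planeProj x) √(t ^ 2 - x 2 ^ 2) *
        (∂_{timeDir} ψ : SpaceTimeTestFunction) (x, t) =
      -(2 * ∫ t, waveDensity f (x, t) * ψ (x, t)) := by
  have h_support : tsupport (fun t => ψ (x, t)) ⊆ Ioi |x 2| := fun t ht =>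
    hψ (tsupport_comp_subset_preimage (f := fun t => (x, t)) ψ (by fun_prop) ht)
  have h_compact : HasCompactSupport fun t => ψ (x, t) :=
    HasCompactSupport.intro (ψ.hasCompactSupport.isCompact.image continuous_snd) fun t ht =>
      image_eq_zero_of_notMem_tsupport fun h => ht (mem_image_of_mem Prod.snd h)
  have h_deriv (t : ℝ) : (∂_{timeDir} ψ : SpaceTimeTestFunction) (x, t) =
      deriv (fun t => ψ (x, t)) t := by
    have h_line : HasDerivAt (fun t : ℝ => ((x, t) : SpaceTime)) timeDir t :=
      (hasDerivAt_const t x).prodMk (hasDerivAt_id t)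
    rw [coe_lineDerivOp]
    exact ((ψ.contDiff.differentiable (by simp) (x, t)).hasFDerivAt.comp_hasDerivAt t
      h_line).deriv.symm
  have h_cont : ContinuousOn (fun t => 2 * waveDensity f (x, t)) (Ioi |x 2|) :=
    continuousOn_const.mul ((continuousOn_waveDensity hf).comp (by fun_prop) fun t ht => ht)
  have h_smooth : ContDiff ℝ 1 fun t => ψ (x, t) :=
    (ψ.contDiff.of_le (by simp)).comp (by fun_prop)
  have h_mean (t : ℝ) (ht : t ∈ Ioi |x 2|) := hasDerivAt_sphericalMean_sqrt hf (x := x) (t := t) ht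
  simp only [h_deriv]
  rw [integral_Ioi_mul_deriv_eq_neg h_mean h_cont h_smooth h_compact h_support,
    setIntegral_eq_integral_of_forall_compl_eq_zero fun t ht => ?_]
  · simp only [mul_assoc, integral_const_mul]
  · rw [image_eq_zero_of_notMem_tsupport fun h => ht (h_support h), mul_zero]

end Layer

section Density

variable {f : Plane → ℝ} {p : SpaceTimeDistribution}

theorem measurePreserving_sub_spacePoint :
    MeasurePreserving (fun q : Plane × Space => (q.1, q.2 - spacePoint q.1 0)) := by
  refine (MeasurePreserving.id _).skew_product (g := fun ξ y => y - spacePoint ξ 0)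
    (continuous_snd.sub (continuous_spacePoint_zero.comp continuous_fst)).measurable
    (Eventually.of_forall fun ξ => ?_)
  exact (measurePreserving_sub_right volume (spacePoint ξ 0)).map_eq

theorem integrable_mul_inv_norm_mul (hf : LocallyIntegrable f) {χ : SpaceTime → ℝ}
    (hχ : Continuous χ) {R : ℝ} (hR : ∀ w, R ≤ ‖w‖ → χ w = 0) :
    Integrable fun q : Plane × Space =>
      f q.1 * (‖q.2‖⁻¹ * χ (spacePoint q.1 0 + q.2, ‖q.2‖)) := by
  have h_layer := continuous_spacePoint_zero
  obtain ⟨C, hC⟩ := hχ.bounded_above_of_compact_support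
    (.intro (isCompact_closedBall 0 R) fun w hw => hR w (le_of_lt (by simpa using hw)))
  have h_ball : Integrable ((Metric.closedBall 0 (2 * R)).indicator f) :=
    (integrable_indicator_iff measurableSet_closedBall).2
      (hf.integrableOn_isCompact (isCompact_closedBall 0 (2 * R)))
  refine (h_ball.norm.mul_prod (integrable_indicator_ball_inv_norm_pow (μ := volume) (k := 1)
    (by simp) C R)).mono' ?_ (Eventually.of_forall fun q => ?_)
  · exact hf.aestronglyMeasurable.comp_fst.mul
      ((Measurable.aestronglyMeasurable (by fun_prop)).mul
        (Continuous.aestronglyMeasurable (by fun_prop)))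
  rcases eq_or_ne (χ (spacePoint q.1 0 + q.2, ‖q.2‖)) 0 with h_zero | h_ne
  · rw [h_zero, mul_zero, mul_zero, norm_zero]
    exact mul_nonneg (norm_nonneg _) (indicator_nonneg (fun y _ =>
      mul_nonneg ((norm_nonneg _).trans (hC 0)) (by positivity)) _)
  · have h_lt : ‖(spacePoint q.1 0 + q.2, ‖q.2‖)‖ < R := lt_of_not_ge fun h => h_ne (hR _ h)
    rw [Prod.norm_def, norm_norm, max_lt_iff] at h_lt
    have h_plane : ‖q.1‖ ≤ ‖spacePoint q.1 0 + q.2‖ + ‖q.2‖ := by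
      simpa [norm_spacePoint_zero] using norm_sub_le (spacePoint q.1 0 + q.2) q.2
    rw [indicator_of_mem (by simpa using by linarith), indicator_of_mem (by simpa using h_lt.2),
      norm_mul, norm_mul, norm_inv, norm_norm, pow_one, mul_comm ‖q.2‖⁻¹]
    gcongr
    exact hC _

theorem integrable_mul_inv_norm_sub_mul (hf : LocallyIntegrable f) {χ : SpaceTime → ℝ}
    (hχ : Continuous χ) (hχc : HasCompactSupport χ) :
    Integrable fun q : Plane × Space =>
      f q.1 * (‖q.2 - spacePoint q.1 0‖⁻¹ * χ (q.2, ‖q.2 - spacePoint q.1 0‖)) := by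
  obtain ⟨R, -, hR⟩ := hχc.exists_pos_le_norm
  have h := measurePreserving_sub_spacePoint.integrable_comp_of_integrable
    (integrable_mul_inv_norm_mul hf hχ hR)
  simpa only [Function.comp_def, add_sub_cancel] using h

theorem advancedPotential_spacePoint (χ : SpaceTime → ℝ) (ξ : Plane) :
    advancedPotential χ (spacePoint ξ 0, 0) = (4 * Real.pi)⁻¹ *
      ∫ x, ‖x - spacePoint ξ 0‖⁻¹ * χ (x, ‖x - spacePoint ξ 0‖) := by
  rw [advancedPotential, coneIntegral, ← integral_sub_right_eq_self _ (spacePoint ξ 0)]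
  simp only [coneDist_zero, pow_one, Pi.one_apply, one_div, Prod.mk_add_mk, add_sub_cancel,
    zero_add]

theorem IsPressureWave.apply_eq_integral (hp : IsPressureWave f p) (hf : ContDiff ℝ 1 f)
    {ψ : SpaceTimeTestFunction} (hψ : tsupport ψ ⊆ coneInterior) :
    p ψ = ∫ w, waveDensity f w * ψ w := by
  set χ : SpaceTimeTestFunction := ∂_{timeDir} ψ
  have h_fubini := integrable_mul_inv_norm_sub_mul hf.continuous.locallyIntegrable χ.continuous
    χ.hasCompactSupport
  have h_layer : ∀ᵐ x : Space,
      ∫ ξ, f ξ * (‖x - spacePoint ξ 0‖⁻¹ * χ (x, ‖x - spacePoint ξ 0‖)) =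
        -(4 * Real.pi * ∫ t, waveDensity f (x, t) * ψ (x, t)) := by
    filter_upwards [h_fubini.prod_left_ae] with x hx
    rw [integral_mul_comp_norm_sub_spacePoint (g := fun t => χ (x, t)) x hx,
      integral_sphericalMean_mul_lineDerivOp_timeDir hf hψ]
    ring
  have h_density := integrable_mul_of_continuousOn_of_tsupport_subset (μ := volume)
    isOpen_coneInterior (continuousOn_waveDensity hf) ψ.continuous ψ.hasCompactSupport hψ
  calc p ψ
      = -((4 * Real.pi)⁻¹ * ∫ ξ, ∫ x, f ξ * (‖x - spacePoint ξ 0‖⁻¹ *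
          χ (x, ‖x - spacePoint ξ 0‖))) := by
        rw [hp.apply_eq_neg_sheet, sheet]
        simp only [advancedPotential_spacePoint, integral_const_mul,
          mul_left_comm (f _) (4 * Real.pi)⁻¹, χ]
    _ = -((4 * Real.pi)⁻¹ * ∫ x : Space, -(4 * Real.pi *
          ∫ t, waveDensity f (x, t) * ψ (x, t))) := by
        rw [integral_integral_swap h_fubini, integral_congr_ae h_layer]
    _ = ∫ x : Space, ∫ t, waveDensity f (x, t) * ψ (x, t) := by
        rw [integral_neg, integral_const_mul, mul_neg, neg_neg,
          inv_mul_cancel_left₀ (by positivity)]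
    _ = ∫ w, waveDensity f w * ψ w := (integral_prod _ h_density).symm

end Density

section PointValue

theorem eqOn_of_integral_mul_eq {E : Type*} [NormedAddCommGroup E] [NormedSpace ℝ E]
    [FiniteDimensional ℝ E] [MeasurableSpace E] [BorelSpace E] {μ : Measure E}
    [IsLocallyFiniteMeasure μ] [μ.IsOpenPosMeasure] {U : Set E} {g h : E → ℝ} (hU : IsOpen U)
    (hg : ContinuousOn g U) (hh : ContinuousOn h U)
    (h_eq : ∀ φ : E → ℝ, ContDiff ℝ ∞ φ → HasCompactSupport φ → tsupport φ ⊆ U →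
      ∫ x, g x * φ x ∂μ = ∫ x, h x * φ x ∂μ) : EqOn g h U := by
  have h_ae : ∀ᵐ x ∂μ, x ∈ U → g x - h x = 0 := by
    refine hU.ae_eq_zero_of_integral_contDiff_smul_eq_zero
      ((hg.sub hh).locallyIntegrableOn hU.measurableSet) fun φ hφ hφc hφU => ?_
    simp only [smul_eq_mul, mul_comm (φ _), sub_mul]
    rw [integral_sub (integrable_mul_of_continuousOn_of_tsupport_subset hU hg hφ.continuous hφc hφU)
      (integrable_mul_of_continuousOn_of_tsupport_subset hU hh hφ.continuous hφc hφU),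
      h_eq φ hφ hφc hφU, sub_self]
  refine Measure.eqOn_open_of_ae_eq (μ := μ) ((ae_restrict_iff' hU.measurableSet).2 ?_) hU hg hh
  exact h_ae.mono fun x hx hxU => sub_eq_zero.1 (hx hxU)

variable {f : Plane → ℝ} {p : SpaceTimeDistribution} {y : SpaceTime} {v v' : ℝ}

theorem HasPointValue.unique (h : HasPointValue p y v) (h' : HasPointValue p y v') : v = v' := by
  obtain ⟨U, g, hU, hyU, hg, hpg, rfl⟩ := h
  obtain ⟨U', g', hU', hyU', hg', hpg', rfl⟩ := h'
  refine eqOn_of_integral_mul_eq (μ := volume) (hU.inter hU') (hg.mono inter_subset_left)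
    (hg'.mono inter_subset_right) (fun φ hφ hφc hφU => ?_) ⟨hyU, hyU'⟩
  let ψ : SpaceTimeTestFunction := ⟨φ, hφ, hφc, subset_univ _⟩
  exact (hpg ψ (hφU.trans inter_subset_left)).symm.trans (hpg' ψ (hφU.trans inter_subset_right))

theorem HasPointValue.pointValue_eq (h : HasPointValue p y v) : pointValue p y = v := by
  have h_ex : ∃ v, HasPointValue p y v := ⟨v, h⟩
  rw [pointValue, dif_pos h_ex]
  exact h_ex.choose_spec.unique h

theorem IsPressureWave.hasPointValue (hp : IsPressureWave f p) (hf : ContDiff ℝ 1 f) {w : SpaceTime}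
    (hw : w ∈ coneInterior) : HasPointValue p w (waveDensity f w) :=
  ⟨coneInterior, waveDensity f, isOpen_coneInterior, hw, continuousOn_waveDensity hf,
    fun _ hψ => hp.apply_eq_integral hf hψ, rfl⟩

theorem spacePoint_zero_mem_coneInterior (ξ : Plane) {t : ℝ} (ht : 0 < t) :
    (spacePoint ξ 0, t) ∈ coneInterior := by
  simpa [coneInterior, spacePoint] using ht

theorem waveDensity_spacePoint_zero (f : Plane → ℝ) (ξ : Plane) {t : ℝ} (ht : 0 < t) :
    waveDensity f (spacePoint ξ 0, t) = 2⁻¹ * sphericalMeanDeriv f ξ t := by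
  have h_height : spacePoint ξ 0 2 = 0 := by simp [spacePoint]
  simp only [waveDensity, planeProj_spacePoint, h_height]
  rw [zero_pow two_ne_zero, sub_zero, Real.sqrt_sq ht.le, div_self ht.ne', mul_one]

theorem IsPressureWave.hasPointValue_pointData (hp : IsPressureWave f p) (hf : ContDiff ℝ 1 f)
    (ξ : Plane) {t : ℝ} (ht : 0 < t) : HasPointValue p (spacePoint ξ 0, t) (pointData p ξ t) := by
  have h := hp.hasPointValue hf (spacePoint_zero_mem_coneInterior ξ ht)
  rwa [pointData, h.pointValue_eq]

theorem IsPressureWave.pointData_eq (hp : IsPressureWave f p) (hf : ContDiff ℝ 1 f) (ξ : Plane)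
    {t : ℝ} (ht : 0 < t) : pointData p ξ t = 2⁻¹ * sphericalMeanDeriv f ξ t := by
  rw [← waveDensity_spacePoint_zero f ξ ht]
  exact (hp.hasPointValue hf (spacePoint_zero_mem_coneInterior ξ ht)).pointValue_eq

theorem IsPressureWave.intervalIntegrable_pointData (hp : IsPressureWave f p) (hf : ContDiff ℝ 1 f)
    (ξ : Plane) {t : ℝ} (ht : 0 ≤ t) : IntervalIntegrable (pointData p ξ) volume 0 t := by
  have h_cont : Continuous fun s => 2⁻¹ * sphericalMeanDeriv f ξ s :=
    continuous_const.mul ((continuous_sphericalMeanDeriv hf).comp (by fun_prop : Continuous (ξ, ·)))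
  refine (h_cont.intervalIntegrable 0 t).congr fun s hs => ?_
  rw [uIoc_of_le ht] at hs
  exact (hp.pointData_eq hf ξ hs.1).symm

theorem IsPressureWave.sphericalMean_eq (hp : IsPressureWave f p) (hf : ContDiff ℝ 1 f) (ξ : Plane)
    {t : ℝ} (ht : 0 ≤ t) :
    sphericalMean f ξ t = f ξ + 2 * ∫ s in (0 : ℝ)..t, pointData p ξ s := by
  have h_ftc : ∫ s in (0 : ℝ)..t, 2 * pointData p ξ s =
      sphericalMean f ξ t - sphericalMean f ξ 0 := by
    refine intervalIntegral.integral_eq_sub_of_hasDerivAt_of_le ht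
      ((continuous_sphericalMean hf.continuous).comp (by fun_prop : Continuous (ξ, ·))).continuousOn
      (fun s hs => ?_) ((hp.intervalIntegrable_pointData hf ξ ht).const_mul 2)
    rw [hp.pointData_eq hf ξ hs.1, mul_inv_cancel_left₀ two_ne_zero]
    exact hasDerivAt_sphericalMean hf ξ s
  rw [← intervalIntegral.integral_const_mul, h_ftc, sphericalMean_zero, add_sub_cancel]

end PointValue

end Photoacoustic

end

open Photoacoustic in
theorem mainTheorem3_general {f : Plane → ℝ} (hf : ContDiff ℝ 1 f) {p : SpaceTimeDistribution}
    (hp : IsPressureWave f p) {Γ : Set Plane} (hΓ : ∀ ξ ∈ Γ, f ξ = 0) :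
    (∀ ξ ∈ Γ, ∀ t : ℝ, 0 < t →
      HasPointValue p (spacePoint ξ 0, t) (pointData p ξ t) ∧
      IntervalIntegrable (fun s : ℝ => pointData p ξ s) volume 0 t ∧
      sphericalMean f ξ t = 2 * ∫ s in (0 : ℝ)..t, pointData p ξ s) ∧
    (∀ (R : (Γ → Ioi (0 : ℝ) → ℝ) → (Plane → ℝ)) (𝒢 : Set (Plane → ℝ)), f ∈ 𝒢 →
      (∀ g ∈ 𝒢, R (fun ξ t => sphericalMean g ξ t) = g) →
      R (fun ξ t => 2 * ∫ s in (0 : ℝ)..t, pointData p ξ s) = f) := by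
  have h_mean (ξ : Plane) (hξ : ξ ∈ Γ) (t : ℝ) (ht : 0 < t) :
      sphericalMean f ξ t = 2 * ∫ s in (0 : ℝ)..t, pointData p ξ s := by
    rw [hp.sphericalMean_eq hf ξ ht.le, hΓ ξ hξ, zero_add]
  refine ⟨fun ξ hξ t ht => ⟨hp.hasPointValue_pointData hf ξ ht,
    hp.intervalIntegrable_pointData hf ξ ht.le, h_mean ξ hξ t ht⟩, fun R 𝒢 hf𝒢 hR => ?_⟩
  rw [← hR f hf𝒢]
  congr 1
  ext ξ t
  rw [h_mean ξ ξ.2 t t.2]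

theorem mainTheorem3 (Ω : Set Photoacoustic.Plane) (hΩ : IsOpen Ω)
    (f : Photoacoustic.Plane → ℝ) (hf : ContDiff ℝ ∞ f) (hfc : HasCompactSupport f)
    (hfΩ : tsupport f ⊆ Ω)
    (p : Photoacoustic.SpaceTimeDistribution) (hp : Photoacoustic.IsPressureWave f p) :
    (∀ ξ ∈ frontier Ω, ∀ t : ℝ, 0 < t →
      Photoacoustic.HasPointValue p (Photoacoustic.spacePoint ξ 0, t)
        (Photoacoustic.pointData p ξ t) ∧
      IntervalIntegrable (fun s : ℝ => Photoacoustic.pointData p ξ s) volume 0 t ∧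
      Photoacoustic.sphericalMean f ξ t =
        2 * ∫ s in (0 : ℝ)..t, Photoacoustic.pointData p ξ s) ∧
    (∀ R : (frontier Ω → Ioi (0 : ℝ) → ℝ) → (Photoacoustic.Plane → ℝ),
      (∀ g : Photoacoustic.Plane → ℝ, ContDiff ℝ ∞ g → HasCompactSupport g → tsupport g ⊆ Ω →
        R (fun ξ t => Photoacoustic.sphericalMean g ξ t) = g) →
      R (fun ξ t => 2 * ∫ s in (0 : ℝ)..t, Photoacoustic.pointData p ξ s) = f) := by
  have h_zero (ξ : Photoacoustic.Plane) (hξ : ξ ∈ frontier Ω) : f ξ = 0 :=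
    image_eq_zero_of_notMem_tsupport fun h => (hΩ.frontier_eq ▸ hξ).2 (hfΩ h)
  have h_general := mainTheorem3_general (hf.of_le (by simp)) hp h_zero
  exact ⟨h_general.1, fun R hR => h_general.2 R {g | ContDiff ℝ ∞ g ∧ HasCompactSupport g ∧
    tsupport g ⊆ Ω} ⟨hf, hfc, hfΩ⟩ fun g hg => hR g hg.1 hg.2.1 hg.2.2⟩
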